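/- Let $n\ge 1$, let $\|\cdot\|$ be the Euclidean norm on $\mathbb{R}^n$ and the induced operator norm on real $n\times n$ matrices, and let $\mathcal B$ be the closed unit ball of matrices for this norm. For $f:\mathbb{R}^n\to\mathbb{R}^n$ and $x\in\mathbb{R}^n$, the Clarke generalized Jacobian $\partial f(x)$ is the convex hull of all matrices $M=\lim_{i\to\infty}Jf(x_i)$, where $x_i\to x$, $f$ is differentiable at every $x_i$, and $Jf(x_i)$ is the Jacobian matrix of $f$ at $x_i$. It is of maximal rank if every $M\in\partial f(x)$ has rank $n$. Theorem. Let $f:\mathbb{R}^n\to\mathbb{R}^n$ and $x_0\in\mathbb{R}^n$ be such that $\partial f(x_0)$ is of maximal rank, and put $$\delta=\frac12\inf_{M\in\partial f(x_0)}\frac1{\|M^{-1}\|}.$$ Let $r>0$ and $K\ge 0$ be such that on the open ball $\{x:\|x-x_0\|<r\}$ the map $f$ is Lipschitz with constant $K$ (for instance, $f$ is $K$-Lipschitz on all of $\mathbb{R}^n$) and such that $\partial f(x)\subset\partial f(x_0)+\delta\mathcal B$ for every $x$ in this ball. Then $\delta>0$, $K>0$, and for the neighborhoods $$U=\Big\{x:\|x-x_0\|\le\frac{r\delta}{2K}\Big\},\qquad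 V=\Big\{y:\|y-f(x_0)\|\le\frac{r\delta}{2}\Big\}$$ of $x_0$ and $f(x_0)$ we have $f(U)\subset V$, and there is a mapping $g:V\to\mathbb{R}^n$ that is Lipschitz with Lipschitz constant $1/\delta$, that is, $\|g(v)-g(v')\|\le\frac1\delta\|v-v'\|$ for all $v,v'\in V$, such that (a) $g(f(u))=u$ for every $u\in U$, (b) $f(g(v))=v$ for every $v\in V$. -/

import Mathlib

open Set Filter Topology Metric
open scoped NNReal Pointwise
-- `‖M‖` of a real matrix is the operator norm with respect to the Euclidean norms.
open scoped Matrix.Norms.L2Operator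

noncomputable section

/-- The usual `n × m` Jacobian matrix of partial derivatives of `f : ℝᵐ → ℝⁿ` at `x`
(meaningful where `f` is differentiable): its `(i, j)` entry is `∂fᵢ/∂xⱼ (x)`. -/
def jacobianMatrix {m n : ℕ} (f : EuclideanSpace ℝ (Fin m) → EuclideanSpace ℝ (Fin n))
    (x : EuclideanSpace ℝ (Fin m)) : Matrix (Fin n) (Fin m) ℝ :=
  Matrix.of fun i j => (fderiv ℝ f x (EuclideanSpace.single j 1)) i

/-- Clarke's generalized Jacobian `∂f(x₀)`: the convex hull of all matrices
`M = lim Jf(xᵢ)`, where `xᵢ → x₀` and `f` is differentiable at every `xᵢ`. -/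
def generalizedJacobian {m n : ℕ}
    (f : EuclideanSpace ℝ (Fin m) → EuclideanSpace ℝ (Fin n))
    (x₀ : EuclideanSpace ℝ (Fin m)) : Set (Matrix (Fin n) (Fin m) ℝ) :=
  convexHull ℝ {M | ∃ u : ℕ → EuclideanSpace ℝ (Fin m),
    Tendsto u atTop (𝓝 x₀) ∧ (∀ i, DifferentiableAt ℝ f (u i)) ∧
    Tendsto (fun i => jacobianMatrix f (u i)) atTop (𝓝 M)}

/-- A set of matrices is of maximal rank if each of its members is. -/
def OfMaximalRank {m n : ℕ} (S : Set (Matrix (Fin n) (Fin m) ℝ)) : Prop :=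
  ∀ M ∈ S, M.rank = min n m

/-- `δ = ½ · inf_{M ∈ ∂f(x₀)} 1 / ‖M⁻¹‖`. -/
def clarkeDelta {n : ℕ} (f : EuclideanSpace ℝ (Fin n) → EuclideanSpace ℝ (Fin n))
    (x₀ : EuclideanSpace ℝ (Fin n)) : ℝ :=
  (1 / 2) * sInf ((fun M : Matrix (Fin n) (Fin n) ℝ => 1 / ‖M⁻¹‖) '' generalizedJacobian f x₀)

end

/-!
The inverse function theorem for Lipschitz maps, by regularisation rather than by the calculus of
generalized derivatives.

Extend `f` from the ball to a globally Lipschitz map `F` and average `F` over balls of radius `ε`.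
By Rademacher's theorem and dominated convergence the average `S` is differentiable everywhere,
within `K ε` of `F`, and its derivative at `x` is the average of the derivatives of `F` near `x`
(`exists_differentiable_approx_of_lipschitz`). Hence every closed half-space that contains the
vectors `DF(y) h` for `y` near `x` also contains `DS(x) h`.

The half-spaces come from separation. The generalized Jacobian at `x₀` is convex, compact and made
of invertible matrices, so `δ > 0` and its images `M h` form a compact convex set at distance at
least `2 δ ‖h‖` from the origin. The direction `w` of the nearest point then satisfies
`⟪w, M h⟫ ≥ δ ‖h‖` for all `M` within `δ` of the generalized Jacobian
(`exists_forall_clarkeDelta_mul_norm_le_inner`), in particular for every Jacobian of `f` in the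
ball.

Consequently, on slightly smaller balls, `S` expands distances by the factor `δ` (mean value
theorem). It also reaches every point near `S x₀`: a minimiser of `‖S x - v‖` is interior by
expansion, and there the invertible derivative forces `S x = v`. Both properties survive the limit
`ε → 0` with the same constants, by compactness for the second one
(`LipschitzWith.mul_norm_sub_le_of_le_inner_fderiv`,
`LipschitzWith.closedBall_subset_image_of_le_inner_fderiv`). The map `g` is the resulting inverse.
-/

/-! ### Averages of Lipschitz maps over balls -/

open MeasureTheory in
/-- Averaging a Lipschitz map over balls of radius `ε` gives a map which is differentiable
everywhere, is uniformly close to `F`, and inherits every half-space bound on the derivatives of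
`F`: by Rademacher's theorem its derivative at `x` is the average over `ball x ε` of the derivative
of `F`. -/
theorem exists_differentiable_approx_of_lipschitz {E : Type*} [NormedAddCommGroup E]
    [InnerProductSpace ℝ E] [FiniteDimensional ℝ E] {F : E → E} {K : ℝ≥0} (hF : LipschitzWith K F)
    {ε : ℝ} (hε : 0 < ε) :
    ∃ S : E → E, Differentiable ℝ S ∧ (∀ x, ‖S x - F x‖ ≤ K * ε) ∧
      ∀ (x w h : E) (c : ℝ),
        (∀ y ∈ ball x ε, DifferentiableAt ℝ F y → c ≤ inner ℝ w (fderiv ℝ F y h)) →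
        c ≤ inner ℝ w (fderiv ℝ S x h) := by
  borelize E
  let μ : Measure E := ProbabilityTheory.cond volume (ball (0 : E) ε)
  have : IsProbabilityMeasure μ := ProbabilityTheory.cond_isProbabilityMeasure_of_finite
    (measure_ball_pos _ _ hε).ne' measure_ball_lt_top.ne
  have hmem : ∀ᵐ a ∂μ, a ∈ ball (0 : E) ε := ProbabilityTheory.ae_cond_mem measurableSet_ball
  have hac : μ ≪ volume := ProbabilityTheory.cond_absolutelyContinuous
  have hint : ∀ x, Integrable (fun a => F (x + a)) μ := fun x => by
    refine Integrable.of_bound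
      ((hF.continuous.comp (continuous_const.add continuous_id)).aestronglyMeasurable)
      (‖F x‖ + K * ε) ?_
    filter_upwards [hmem] with a ha
    have h1 := hF.norm_sub_le (x + a) x
    rw [add_sub_cancel_left] at h1
    have h2 : ‖a‖ ≤ ε := (mem_ball_zero_iff.1 ha).le
    have h3 := norm_le_norm_add_norm_sub' (F (x + a)) (F x)
    have h4 : (K : ℝ) * ‖a‖ ≤ K * ε := by gcongr
    linarith
  have hdiff : ∀ x, ∀ᵐ a ∂μ, DifferentiableAt ℝ F (x + a) := fun x =>
    hac.ae_le ((measurePreserving_add_left volume x).quasiMeasurePreserving.ae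
      hF.ae_differentiableAt)
  have hder : ∀ x, Integrable (fun a => fderiv ℝ F (x + a)) μ ∧
      HasFDerivAt (fun x => ∫ a, F (x + a) ∂μ) (∫ a, fderiv ℝ F (x + a) ∂μ) x := fun x => by
    refine hasFDerivAt_integral_of_dominated_loc_of_lip (bound := fun _ => (K : ℝ)) univ_mem
      (Eventually.of_forall fun y => (hint y).aestronglyMeasurable) (hint x)
      ((measurable_fderiv ℝ F).comp (measurable_const_add x)).aestronglyMeasurable
      (Eventually.of_forall fun a => ?_) (integrable_const _) ?_
    · rw [Real.nnabs_of_nonneg K.coe_nonneg, Real.toNNReal_coe, lipschitzOnWith_univ]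
      exact LipschitzWith.of_dist_le_mul fun y z => by
        simpa using hF.dist_le_mul (y + a) (z + a)
    · filter_upwards [hdiff x] with a ha
      exact (hasFDerivAt_comp_add_right a).2 ha.hasFDerivAt
  refine ⟨fun x => ∫ a, F (x + a) ∂μ, fun x => (hder x).2.differentiableAt, fun x => ?_, ?_⟩
  · have h1 : (∫ a, F (x + a) ∂μ) - F x = ∫ a, (F (x + a) - F x) ∂μ := by
      rw [integral_sub (hint x) (integrable_const _)]
      simp
    rw [h1]
    refine (norm_integral_le_of_norm_le_const (C := K * ε) ?_).trans (by simp)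
    filter_upwards [hmem] with a ha
    have h2 := hF.norm_sub_le (x + a) x
    rw [add_sub_cancel_left] at h2
    have h3 : ‖a‖ ≤ ε := (mem_ball_zero_iff.1 ha).le
    exact h2.trans (by gcongr)
  · intro x w h c hc
    rw [(hder x).2.fderiv, ContinuousLinearMap.integral_apply (hder x).1]
    have h1 : Integrable (fun a => fderiv ℝ F (x + a) h) μ := (hder x).1.apply_continuousLinearMap h
    rw [← integral_inner h1 w]
    have h2 : ∫ _a, c ∂μ = c := by simp
    rw [← h2]
    refine integral_mono_ae (integrable_const _) (h1.const_inner w) ?_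
    filter_upwards [hmem, hdiff x] with a ha hd
    exact hc _ (by simpa using ha) hd

/-! ### Expansion and surjectivity for differentiable maps -/

section DifferentiableMaps

variable {E : Type*} [NormedAddCommGroup E] [InnerProductSpace ℝ E]
  {S : E → E} {x₀ : E} {δ ρ : ℝ}

/-- If the derivatives in each direction `h` stay in a common half-space at distance `δ ‖h‖` from
the origin, the mean value theorem along segments makes the map expanding by the factor `δ`. -/
theorem mul_norm_sub_le_of_le_inner_fderiv (hS : Differentiable ℝ S)
    (hw : ∀ h, ∃ w : E, ‖w‖ ≤ 1 ∧ ∀ x ∈ ball x₀ ρ, δ * ‖h‖ ≤ inner ℝ w (fderiv ℝ S x h))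
    {x y : E} (hx : x ∈ ball x₀ ρ) (hy : y ∈ ball x₀ ρ) :
    δ * ‖y - x‖ ≤ ‖S y - S x‖ := by
  obtain ⟨w, hw1, hw⟩ := hw (y - x)
  let φ : ℝ → ℝ := fun t => inner ℝ w (S (AffineMap.lineMap x y t))
  have hφ : ∀ t, HasDerivAt φ
      (inner ℝ w (fderiv ℝ S (AffineMap.lineMap x y t) (y - x))) t := fun t =>
    (innerSL ℝ w).hasFDerivAt.comp_hasDerivAt t
      ((hS _).hasFDerivAt.comp_hasDerivAt t AffineMap.hasDerivAt_lineMap)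
  have hmv := (convex_Icc (0 : ℝ) 1).mul_sub_le_image_sub_of_le_deriv
    (f := φ) (C := δ * ‖y - x‖) (fun t _ => (hφ t).continuousAt.continuousWithinAt)
    (fun t _ => (hφ t).differentiableAt.differentiableWithinAt)
    (fun t ht => by
      rw [(hφ t).deriv]
      exact hw _ ((convex_ball x₀ ρ).lineMap_mem hx hy (interior_subset ht)))
    0 (by simp) 1 (by simp) zero_le_one
  have h1 : φ 1 - φ 0 = inner ℝ w (S y - S x) := by simp [φ, inner_sub_right]
  rw [h1] at hmv
  have h2 := real_inner_le_norm w (S y - S x)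
  have h3 : ‖w‖ * ‖S y - S x‖ ≤ 1 * ‖S y - S x‖ := by gcongr
  linarith

/-- A point minimising `‖S x - v‖` over `closedBall x₀ s` is interior because `S` expands, and
there invertibility of the derivative forces `S x = v`. -/
theorem exists_eq_of_le_inner_fderiv [FiniteDimensional ℝ E] (hS : Differentiable ℝ S)
    (hw : ∀ h, ∃ w : E, ‖w‖ ≤ 1 ∧ ∀ x ∈ ball x₀ ρ, δ * ‖h‖ ≤ inner ℝ w (fderiv ℝ S x h))
    (hδ : 0 < δ) {s : ℝ} (hs : 0 ≤ s) (hsρ : s < ρ) {v : E} (hv : ‖S x₀ - v‖ < δ * s / 2) :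
    ∃ x ∈ closedBall x₀ s, S x = v := by
  have hx₀ : x₀ ∈ closedBall x₀ s := mem_closedBall_self hs
  obtain ⟨x, hxs, hmin⟩ := (isCompact_closedBall x₀ s).exists_isMinOn ⟨x₀, hx₀⟩
    (f := fun x => ‖S x - v‖ ^ 2) ((hS.continuous.sub continuous_const).norm.pow 2).continuousOn
  have hxρ : x ∈ ball x₀ ρ := closedBall_subset_ball hsρ hxs
  have hle : ‖S x - v‖ ≤ ‖S x₀ - v‖ := by
    have h := isMinOn_iff.1 hmin x₀ hx₀
    exact (pow_le_pow_iff_left₀ (norm_nonneg _) (norm_nonneg _) two_ne_zero).1 h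
  have hlt : x ∈ ball x₀ s := by
    have h1 := mul_norm_sub_le_of_le_inner_fderiv hS hw
      (mem_ball_self (hs.trans_lt hsρ)) hxρ
    have h2 : ‖S x - S x₀‖ ≤ ‖S x - v‖ + ‖S x₀ - v‖ := by
      rw [norm_sub_rev (S x₀) v]; exact norm_sub_le_norm_sub_add_norm_sub _ _ _
    rw [mem_ball_iff_norm]
    by_contra! h3
    have h4 : δ * s ≤ δ * ‖x - x₀‖ := by gcongr
    linarith
  refine ⟨x, hxs, ?_⟩
  have hloc : IsLocalMin (fun x => ‖S x - v‖ ^ 2) x :=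
    hmin.isLocalMin (mem_of_superset (isOpen_ball.mem_nhds hlt) ball_subset_closedBall)
  have hinj : Function.Injective (fderiv ℝ S x : E →ₗ[ℝ] E) := by
    rw [← LinearMap.ker_eq_bot, LinearMap.ker_eq_bot']
    intro h hh
    obtain ⟨w, -, hw⟩ := hw h
    have h1 := hw x hxρ
    rw [show fderiv ℝ S x h = 0 from hh, inner_zero_right] at h1
    exact norm_le_zero_iff.1 (nonpos_of_mul_nonpos_right h1 hδ)
  obtain ⟨h, hh⟩ := (LinearMap.injective_iff_surjective.1 hinj) (S x - v)
  have hd := hloc.hasFDerivAt_eq_zero ((hS x).hasFDerivAt.sub_const v).norm_sq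
  have h2 := congrArg (fun L : E →L[ℝ] ℝ => L h) hd
  replace hh : fderiv ℝ S x h = S x - v := hh
  simp [hh] at h2
  rw [← inner_sub_left, inner_self_eq_zero] at h2
  exact sub_eq_zero.1 h2

end DifferentiableMaps

/-! ### Expansion and surjectivity for Lipschitz maps -/

section LipschitzMaps

variable {E : Type*} [NormedAddCommGroup E] [InnerProductSpace ℝ E] [FiniteDimensional ℝ E]
  {F : E → E} {x₀ : E} {δ r : ℝ} {K : ℝ≥0}

/-- Differentiable approximants of `F` which satisfy, on any smaller ball, the same half-space
condition as `F`. -/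
theorem exists_differentiable_approx_le_inner_fderiv (hF : LipschitzWith K F)
    (hw : ∀ h, ∃ w : E, ‖w‖ ≤ 1 ∧ ∀ x ∈ ball x₀ r, DifferentiableAt ℝ F x →
      δ * ‖h‖ ≤ inner ℝ w (fderiv ℝ F x h)) {ε : ℝ} (hε : 0 < ε) :
    ∃ S : E → E, Differentiable ℝ S ∧ (∀ x, ‖S x - F x‖ ≤ K * ε) ∧
      ∀ h, ∃ w : E, ‖w‖ ≤ 1 ∧ ∀ x ∈ ball x₀ (r - ε), δ * ‖h‖ ≤ inner ℝ w (fderiv ℝ S x h) := by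
  obtain ⟨S, hS, hSF, hSw⟩ := exists_differentiable_approx_of_lipschitz hF hε
  refine ⟨S, hS, hSF, fun h => ?_⟩
  obtain ⟨w, hw1, hw⟩ := hw h
  refine ⟨w, hw1, fun x hx => hSw x w h _ fun y hy => hw y ?_⟩
  refine ball_subset_ball' ?_ hy
  rw [mem_ball] at hx
  linarith

theorem LipschitzWith.mul_norm_sub_le_of_le_inner_fderiv (hF : LipschitzWith K F)
    (hw : ∀ h, ∃ w : E, ‖w‖ ≤ 1 ∧ ∀ x ∈ ball x₀ r, DifferentiableAt ℝ F x →
      δ * ‖h‖ ≤ inner ℝ w (fderiv ℝ F x h))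
    {x y : E} (hx : x ∈ ball x₀ r) (hy : y ∈ ball x₀ r) :
    δ * ‖y - x‖ ≤ ‖F y - F x‖ := by
  have hlim : Tendsto (fun ε : ℝ => ‖F y - F x‖ + 2 * (K * ε)) (𝓝[>] 0) (𝓝 ‖F y - F x‖) := by
    have : Continuous fun ε : ℝ => ‖F y - F x‖ + 2 * (K * ε) := by fun_prop
    simpa using (this.tendsto 0).mono_left nhdsWithin_le_nhds
  refine ge_of_tendsto hlim ?_
  have hm : ∀ᶠ ε : ℝ in 𝓝[>] 0, ε < min (r - dist x x₀) (r - dist y x₀) :=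
    nhdsWithin_le_nhds (eventually_lt_nhds (lt_min (sub_pos.2 hx) (sub_pos.2 hy)))
  filter_upwards [hm, self_mem_nhdsWithin] with ε hε (hε0 : 0 < ε)
  rw [lt_min_iff] at hε
  obtain ⟨S, hS, hSF, hSw⟩ := exists_differentiable_approx_le_inner_fderiv hF hw hε0
  have h1 := _root_.mul_norm_sub_le_of_le_inner_fderiv hS hSw
    (x := x) (y := y) (mem_ball.2 (by linarith)) (mem_ball.2 (by linarith))
  have h2 : S y - S x = (F y - F x) + (S y - F y) - (S x - F x) := by abel
  have h3 : ‖S y - S x‖ ≤ ‖F y - F x‖ + ‖S y - F y‖ + ‖S x - F x‖ := by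
    rw [h2]; exact (_root_.norm_sub_le _ _).trans (by gcongr; exact norm_add_le _ _)
  linarith [hSF x, hSF y]

theorem LipschitzWith.closedBall_subset_image_of_le_inner_fderiv (hF : LipschitzWith K F)
    (hw : ∀ h, ∃ w : E, ‖w‖ ≤ 1 ∧ ∀ x ∈ ball x₀ r, DifferentiableAt ℝ F x →
      δ * ‖h‖ ≤ inner ℝ w (fderiv ℝ F x h)) (hδ : 0 < δ) (hr : 0 < r) :
    closedBall (F x₀) (r * δ / 2) ⊆ F '' closedBall x₀ (r / 2) := by
  have hclosed : ∀ s, IsClosed (F '' closedBall x₀ s) := fun s =>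
    ((isCompact_closedBall x₀ s).image hF.continuous).isClosed
  -- The strict inequality leaves room for the approximation error, so the open ball comes first.
  suffices ball (F x₀) (r * δ / 2) ⊆ F '' closedBall x₀ (r / 2) by
    rw [← closure_ball _ (by positivity)]
    exact closure_minimal this (hclosed _)
  intro v hv
  rw [mem_ball_iff_norm'] at hv
  obtain ⟨s, hs1, hsr⟩ : ∃ s, 2 * ‖F x₀ - v‖ / δ < s ∧ s < r :=
    exists_between (by rw [div_lt_iff₀ hδ]; linarith)
  have hs0 : 0 ≤ s := le_trans (by positivity) hs1.le
  have hv' : ‖F x₀ - v‖ < δ * s / 2 := by rw [div_lt_iff₀ hδ] at hs1; linarith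
  have hvs : v ∈ F '' closedBall x₀ s := by
    rw [← (hclosed s).closure_eq, Metric.mem_closure_iff]
    intro η hη
    have hm : ∀ᶠ ε : ℝ in 𝓝[>] 0, K * ε < min η (δ * s / 2 - ‖F x₀ - v‖) := by
      have : Tendsto (fun ε : ℝ => (K : ℝ) * ε) (𝓝 0) (𝓝 0) := by
        simpa using (continuous_const_mul (K : ℝ)).tendsto 0
      exact nhdsWithin_le_nhds
        (this.eventually (eventually_lt_nhds (lt_min hη (sub_pos.2 hv'))))
    have hm2 : ∀ᶠ ε : ℝ in 𝓝[>] 0, ε < r - s :=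
      nhdsWithin_le_nhds (eventually_lt_nhds (sub_pos.2 hsr))
    obtain ⟨ε, hε1, hε2, hε0⟩ := (hm.and (hm2.and self_mem_nhdsWithin)).exists
    rw [lt_min_iff] at hε1
    obtain ⟨S, hS, hSF, hSw⟩ := exists_differentiable_approx_le_inner_fderiv hF hw hε0
    have h1 : ‖S x₀ - v‖ ≤ ‖S x₀ - F x₀‖ + ‖F x₀ - v‖ := norm_sub_le_norm_sub_add_norm_sub _ _ _
    obtain ⟨x, hx, hxv⟩ := exists_eq_of_le_inner_fderiv hS hSw hδ hs0 (by linarith) (v := v)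
      (by linarith [hSF x₀])
    refine ⟨F x, mem_image_of_mem F hx, ?_⟩
    rw [← hxv, dist_eq_norm]
    linarith [hSF x]
  obtain ⟨x, hx, rfl⟩ := hvs
  have h2 := hF.mul_norm_sub_le_of_le_inner_fderiv hw (mem_ball_self hr)
    (closedBall_subset_ball hsr hx)
  refine ⟨x, ?_, rfl⟩
  rw [mem_closedBall_iff_norm]
  rw [norm_sub_rev] at hv
  by_contra! h3
  have h4 : δ * (r / 2) < δ * ‖x - x₀‖ := by gcongr
  linarith

end LipschitzMaps

/-! ### Convex hulls of compact sets -/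

/-- The convex hull of a compact set in finite dimension is compact: by Carathéodory's theorem it
is the image of `stdSimplex × s ^ (d + 1)` under the continuous map `(c, z) ↦ ∑ i, c i • z i`. -/
theorem IsCompact.convexHull_of_finiteDimensional {E : Type*} [NormedAddCommGroup E]
    [NormedSpace ℝ E] [FiniteDimensional ℝ E] {s : Set E} (hs : IsCompact s) :
    IsCompact (convexHull ℝ s) := by
  let m := Module.finrank ℝ E + 1
  let Φ : (Fin m → ℝ) × (Fin m → E) → E := fun p => ∑ i, p.1 i • p.2 i
  have hΦ : Continuous Φ := by fun_prop
  suffices convexHull ℝ s = Φ '' (stdSimplex ℝ (Fin m) ×ˢ univ.pi fun _ => s) by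
    rw [this]
    exact ((isCompact_stdSimplex ℝ (Fin m)).prod (isCompact_univ_pi fun _ => hs)).image hΦ
  refine Subset.antisymm (fun x hx => ?_) ?_
  · have hne : s.Nonempty := convexHull_nonempty_iff.1 ⟨x, hx⟩
    obtain ⟨a, ha⟩ := hne
    obtain ⟨ι, _, z, c, hz, hind, hc, hc1, rfl⟩ := eq_pos_convex_span_of_mem_convexHull hx
    have hcard : Fintype.card ι ≤ Fintype.card (Fin m) := by
      simpa [m] using hind.card_le_finrank_succ.trans
        (Nat.add_le_add_right (Submodule.finrank_le _) 1)
    obtain ⟨e⟩ := Function.Embedding.nonempty_of_card_le hcard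
    -- The missing indices get weight zero and an arbitrary point of `s`.
    refine ⟨(Function.extend e c 0, Function.extend e z fun _ => a), ⟨⟨fun i => ?_, ?_⟩, ?_⟩, ?_⟩
    · by_cases hi : ∃ j, e j = i
      · obtain ⟨j, rfl⟩ := hi
        simpa [e.injective.extend_apply] using (hc j).le
      · simp [Function.extend_apply' _ _ _ hi]
    · rw [← hc1]
      refine (Fintype.sum_of_injective e e.injective _ _ (fun i hi => ?_) fun j => ?_).symm
      · exact Function.extend_apply' _ _ _ hi
      · exact (e.injective.extend_apply _ _ _).symm
    · intro i _
      by_cases hi : ∃ j, e j = i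
      · obtain ⟨j, rfl⟩ := hi
        simpa [e.injective.extend_apply] using hz ⟨j, rfl⟩
      · simpa [Function.extend_apply' _ _ _ hi] using ha
    · refine (Fintype.sum_of_injective e e.injective _ _ (fun i hi => ?_) fun j => ?_).symm
      · simp [Function.extend_apply' _ _ _ hi]
      · simp [e.injective.extend_apply]
  · rintro _ ⟨⟨c, z⟩, ⟨hc, hz⟩, rfl⟩
    exact (convex_convexHull ℝ s).sum_mem (fun i _ => hc.1 i) hc.2
      fun i _ => subset_convexHull ℝ s (hz i (mem_univ i))

/-! ### Separation of a compact convex set from the origin -/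

/-- The separation step: the nearest point `c` to the origin of a compact convex set gives, after
normalisation, a vector `w` whose inner product with every point of the set is at least `‖c‖`. -/
theorem exists_norm_le_one_forall_le_inner {E : Type*} [NormedAddCommGroup E]
    [InnerProductSpace ℝ E] {C : Set E} (hne : C.Nonempty) (hC : IsCompact C)
    (hconv : Convex ℝ C) {a : ℝ} (ha : ∀ c ∈ C, a ≤ ‖c‖) :
    ∃ w : E, ‖w‖ ≤ 1 ∧ ∀ c ∈ C, a ≤ inner ℝ w c := by
  obtain ⟨c₀, hc₀, hmin⟩ := exists_norm_eq_iInf_of_complete_convex hne hC.isComplete hconv 0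
  rw [norm_eq_iInf_iff_real_inner_le_zero hconv hc₀] at hmin
  refine ⟨‖c₀‖⁻¹ • c₀, ?_, fun c hc => (ha c₀ hc₀).trans ?_⟩
  · rw [norm_smul, norm_inv, norm_norm]
    exact inv_mul_le_one
  · have h := hmin c hc
    rw [zero_sub, inner_neg_left, inner_sub_right, real_inner_self_eq_norm_sq] at h
    rw [real_inner_smul_left]
    rcases eq_or_ne ‖c₀‖ 0 with h0 | h0
    · simp [h0]
    · have hpos : 0 < ‖c₀‖ := (norm_nonneg _).lt_of_ne' h0
      rw [inv_mul_eq_div, le_div_iff₀ hpos]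
      nlinarith

/-! ### Compactness of the generalized Jacobian -/

theorem toEuclideanCLM_jacobianMatrix {n : ℕ}
    (f : EuclideanSpace ℝ (Fin n) → EuclideanSpace ℝ (Fin n)) (x : EuclideanSpace ℝ (Fin n)) :
    Matrix.toEuclideanCLM (n := Fin n) (𝕜 := ℝ) (jacobianMatrix f x) = fderiv ℝ f x := by
  apply ContinuousLinearMap.coe_injective
  refine (EuclideanSpace.basisFun (Fin n) ℝ).toBasis.ext fun j => ?_
  ext i
  simp [jacobianMatrix, Matrix.ofLp_toEuclideanCLM]

theorem norm_jacobianMatrix {n : ℕ}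
    (f : EuclideanSpace ℝ (Fin n) → EuclideanSpace ℝ (Fin n)) (x : EuclideanSpace ℝ (Fin n)) :
    ‖jacobianMatrix f x‖ = ‖fderiv ℝ f x‖ := by
  rw [Matrix.cstar_norm_def, toEuclideanCLM_jacobianMatrix]

theorem jacobianMatrix_mem_generalizedJacobian {n : ℕ}
    {f : EuclideanSpace ℝ (Fin n) → EuclideanSpace ℝ (Fin n)} {x : EuclideanSpace ℝ (Fin n)}
    (hx : DifferentiableAt ℝ f x) : jacobianMatrix f x ∈ generalizedJacobian f x :=
  subset_convexHull _ _ ⟨fun _ => x, tendsto_const_nhds, fun _ => hx, tendsto_const_nhds⟩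

/-- The limits of Jacobians at differentiability points tending to `x₀` are the cluster points of
the Jacobian along the filter of such points. -/
theorem setOf_limit_jacobianMatrix_eq {m n : ℕ}
    (f : EuclideanSpace ℝ (Fin m) → EuclideanSpace ℝ (Fin n)) (x₀ : EuclideanSpace ℝ (Fin m)) :
    {M | ∃ u : ℕ → EuclideanSpace ℝ (Fin m),
      Tendsto u atTop (𝓝 x₀) ∧ (∀ i, DifferentiableAt ℝ f (u i)) ∧
      Tendsto (fun i => jacobianMatrix f (u i)) atTop (𝓝 M)} =
    {M | ClusterPt M (map (jacobianMatrix f) (𝓝[{x | DifferentiableAt ℝ f x}] x₀))} := by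
  ext M
  constructor
  · rintro ⟨u, hu, hd, hM⟩
    have h : Tendsto u atTop (𝓝[{x | DifferentiableAt ℝ f x}] x₀) :=
      tendsto_nhdsWithin_iff.2 ⟨hu, Eventually.of_forall hd⟩
    exact hM.mapClusterPt.clusterPt.mono (by
      rw [← Function.comp_def, ← map_map]
      exact map_mono h)
  · intro hM
    obtain ⟨u, hJ, hu⟩ := MapClusterPt.exists_seq_tendsto hM
    rw [tendsto_nhdsWithin_iff] at hu
    obtain ⟨N, hN⟩ := eventually_atTop.1 hu.2
    exact ⟨fun i => u (i + N), (tendsto_add_atTop_iff_nat N).2 hu.1, fun i => hN _ (by omega),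
      (tendsto_add_atTop_iff_nat N).2 hJ⟩

section LipschitzNear

variable {n : ℕ} {f : EuclideanSpace ℝ (Fin n) → EuclideanSpace ℝ (Fin n)}
  {x₀ : EuclideanSpace ℝ (Fin n)} {K : ℝ≥0} {r : ℝ}

theorem LipschitzOnWith.map_jacobianMatrix_le_principal (hr : 0 < r)
    (hLip : LipschitzOnWith K f (ball x₀ r)) :
    map (jacobianMatrix f) (𝓝[{x | DifferentiableAt ℝ f x}] x₀) ≤
      𝓟 (closedBall (0 : Matrix (Fin n) (Fin n) ℝ) K) := by
  rw [le_principal_iff, mem_map]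
  filter_upwards [nhdsWithin_le_nhds (ball_mem_nhds x₀ hr)] with x hx
  rw [mem_preimage, mem_closedBall_zero_iff, norm_jacobianMatrix]
  exact norm_fderiv_le_of_lipschitzOn ℝ (isOpen_ball.mem_nhds hx) hLip

theorem LipschitzOnWith.isCompact_generalizedJacobian (hr : 0 < r)
    (hLip : LipschitzOnWith K f (ball x₀ r)) : IsCompact (generalizedJacobian f x₀) := by
  rw [generalizedJacobian, setOf_limit_jacobianMatrix_eq]
  have : ProperSpace (Matrix (Fin n) (Fin n) ℝ) := FiniteDimensional.proper_real _
  refine IsCompact.convexHull_of_finiteDimensional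
    ((isCompact_closedBall (0 : Matrix (Fin n) (Fin n) ℝ) K).of_isClosed_subset
      isClosed_setOfPred_clusterPt fun M hM => ?_)
  exact isClosed_closedBall.closure_subset (mem_closure_iff_clusterPt.2
    (ClusterPt.mono hM (hLip.map_jacobianMatrix_le_principal hr)))

/-- Rademacher's theorem provides differentiability points tending to `x₀`; their Jacobians are
bounded, so they have a cluster point. -/
theorem LipschitzOnWith.generalizedJacobian_nonempty (hr : 0 < r)
    (hLip : LipschitzOnWith K f (ball x₀ r)) : (generalizedJacobian f x₀).Nonempty := by
  rw [generalizedJacobian, setOf_limit_jacobianMatrix_eq, convexHull_nonempty_iff]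
  have : ProperSpace (Matrix (Fin n) (Fin n) ℝ) := FiniteDimensional.proper_real _
  have hne : (𝓝[{x | DifferentiableAt ℝ f x}] x₀).NeBot := by
    obtain ⟨F, hF, hFf⟩ := hLip.extend_finite_dimension
    have hdense : Dense {x | DifferentiableAt ℝ F x} :=
      MeasureTheory.Measure.dense_of_ae (hF.ae_differentiableAt (μ := MeasureTheory.volume))
    have h : (𝓝[{x | DifferentiableAt ℝ F x}] x₀).NeBot :=
      mem_closure_iff_nhdsWithin_neBot.1 (hdense x₀)
    refine h.mono (le_inf nhdsWithin_le_nhds (le_principal_iff.2 ?_))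
    filter_upwards [self_mem_nhdsWithin, nhdsWithin_le_nhds (ball_mem_nhds x₀ hr)] with x hx hxr
    exact hx.congr_of_eventuallyEq (hFf.eventuallyEq_of_mem (isOpen_ball.mem_nhds hxr))
  obtain ⟨M, -, hM⟩ := (isCompact_closedBall (0 : Matrix (Fin n) (Fin n) ℝ) K).exists_clusterPt
    (hLip.map_jacobianMatrix_le_principal hr)
  exact ⟨M, hM⟩

end LipschitzNear

/-! ### Separation for generalized Jacobians of maximal rank -/

theorem Matrix.isUnit_of_rank_eq {n : ℕ} {M : Matrix (Fin n) (Fin n) ℝ} (hM : M.rank = n) :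
    IsUnit M := by
  rw [← Matrix.mulVec_surjective_iff_isUnit]
  have h : LinearMap.range M.mulVecLin = ⊤ :=
    Submodule.eq_top_of_finrank_eq (by rw [← Matrix.rank, hM]; simp)
  exact LinearMap.range_eq_top.1 h

theorem Matrix.norm_inv_pos {n : ℕ} (hn : 0 < n) {M : Matrix (Fin n) (Fin n) ℝ} (hM : IsUnit M) :
    0 < ‖M⁻¹‖ := by
  have : Nonempty (Fin n) := ⟨⟨0, hn⟩⟩
  rw [norm_pos_iff]
  exact ((Matrix.isUnit_nonsing_inv_iff).2 hM).ne_zero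

theorem Matrix.norm_le_norm_inv_mul_norm_toEuclideanCLM {n : ℕ} {M : Matrix (Fin n) (Fin n) ℝ}
    (hM : IsUnit M) (h : EuclideanSpace ℝ (Fin n)) :
    ‖h‖ ≤ ‖M⁻¹‖ * ‖Matrix.toEuclideanCLM (n := Fin n) (𝕜 := ℝ) M h‖ := by
  have h1 : Matrix.toEuclideanCLM (n := Fin n) (𝕜 := ℝ) M⁻¹
      (Matrix.toEuclideanCLM (n := Fin n) (𝕜 := ℝ) M h) = h := by
    rw [← mul_apply_eq_comp, ← map_mul,
      Matrix.nonsing_inv_mul _ ((Matrix.isUnit_iff_isUnit_det M).1 hM), map_one,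
      one_apply_eq_self]
  conv_lhs => rw [← h1]
  rw [Matrix.cstar_norm_def]
  exact ContinuousLinearMap.le_opNorm _ _

section MaximalRank

variable {n : ℕ} {f : EuclideanSpace ℝ (Fin n) → EuclideanSpace ℝ (Fin n)}
  {x₀ : EuclideanSpace ℝ (Fin n)}

theorem OfMaximalRank.isUnit {S : Set (Matrix (Fin n) (Fin n) ℝ)} (hS : OfMaximalRank S)
    {M : Matrix (Fin n) (Fin n) ℝ} (hM : M ∈ S) : IsUnit M :=
  Matrix.isUnit_of_rank_eq ((hS M hM).trans (min_self n))

/-- The infimum defining `clarkeDelta` is attained, because `M ↦ 1 / ‖M⁻¹‖` is continuous on the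
compact set `generalizedJacobian f x₀` of invertible matrices. -/
theorem clarkeDelta_pos (hn : 0 < n) (hrank : OfMaximalRank (generalizedJacobian f x₀))
    (hcpt : IsCompact (generalizedJacobian f x₀)) (hne : (generalizedJacobian f x₀).Nonempty) :
    0 < clarkeDelta f x₀ := by
  have hcont : ContinuousOn (fun M : Matrix (Fin n) (Fin n) ℝ => 1 / ‖M⁻¹‖)
      (generalizedJacobian f x₀) := by
    intro M hM
    have hu := hrank.isUnit hM
    have h1 : ContinuousAt (fun A : Matrix (Fin n) (Fin n) ℝ => A⁻¹) M :=
      continuousAt_matrix_inv M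
        (by
          simpa using continuousAt_inv₀ ((Matrix.isUnit_iff_isUnit_det M).1 hu).ne_zero)
    exact (continuousAt_const.div h1.norm (Matrix.norm_inv_pos hn hu).ne').continuousWithinAt
  obtain ⟨M, hM, heq⟩ := (hcpt.image_of_continuousOn hcont).sInf_mem (hne.image _)
  have h := Matrix.norm_inv_pos hn (hrank.isUnit hM)
  rw [clarkeDelta, ← heq]
  positivity

theorem two_mul_clarkeDelta_mul_norm_le (hn : 0 < n)
    (hrank : OfMaximalRank (generalizedJacobian f x₀)) {M : Matrix (Fin n) (Fin n) ℝ}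
    (hM : M ∈ generalizedJacobian f x₀) (h : EuclideanSpace ℝ (Fin n)) :
    2 * clarkeDelta f x₀ * ‖h‖ ≤ ‖Matrix.toEuclideanCLM (n := Fin n) (𝕜 := ℝ) M h‖ := by
  have hu := hrank.isUnit hM
  have hpos := Matrix.norm_inv_pos hn hu
  have h1 : 2 * clarkeDelta f x₀ ≤ 1 / ‖M⁻¹‖ := by
    have h2 : sInf ((fun M : Matrix (Fin n) (Fin n) ℝ => 1 / ‖M⁻¹‖) '' generalizedJacobian f x₀) ≤
        1 / ‖M⁻¹‖ :=
      csInf_le ⟨0, by rintro _ ⟨A, -, rfl⟩; positivity⟩ (mem_image_of_mem _ hM)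
    rw [clarkeDelta]
    linarith
  calc 2 * clarkeDelta f x₀ * ‖h‖ ≤ 1 / ‖M⁻¹‖ * ‖h‖ := by gcongr
    _ ≤ _ := by
      rw [one_div_mul_eq_div, div_le_iff₀' hpos]
      exact Matrix.norm_le_norm_inv_mul_norm_toEuclideanCLM hu h

/-- One vector `w` separates from the origin all the images `M h`, where `M` runs over the
`clarkeDelta`-neighbourhood of the generalized Jacobian: on the Jacobian itself the margin is
`2 * clarkeDelta f x₀ * ‖h‖`, and the perturbation costs at most half of it. -/
theorem exists_forall_clarkeDelta_mul_norm_le_inner (hn : 0 < n)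
    (hrank : OfMaximalRank (generalizedJacobian f x₀))
    (hcpt : IsCompact (generalizedJacobian f x₀)) (hne : (generalizedJacobian f x₀).Nonempty)
    (h : EuclideanSpace ℝ (Fin n)) :
    ∃ w : EuclideanSpace ℝ (Fin n), ‖w‖ ≤ 1 ∧
      ∀ M ∈ generalizedJacobian f x₀ +
          clarkeDelta f x₀ • closedBall (0 : Matrix (Fin n) (Fin n) ℝ) 1,
        clarkeDelta f x₀ * ‖h‖ ≤
          inner ℝ w (Matrix.toEuclideanCLM (n := Fin n) (𝕜 := ℝ) M h) := by
  let T : Matrix (Fin n) (Fin n) ℝ →ₗ[ℝ] EuclideanSpace ℝ (Fin n) :=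
    { toFun := fun M => Matrix.toEuclideanCLM (n := Fin n) (𝕜 := ℝ) M h
      map_add' := fun A B => by simp
      map_smul' := fun c A => by simp }
  have hδ := (clarkeDelta_pos hn hrank hcpt hne).le
  obtain ⟨w, hw1, hw⟩ := exists_norm_le_one_forall_le_inner (hne.image T)
    (hcpt.image T.continuous_of_finiteDimensional) ((convex_convexHull ℝ _).linear_image T)
    (a := 2 * clarkeDelta f x₀ * ‖h‖) (by
      rintro _ ⟨M, hM, rfl⟩
      exact two_mul_clarkeDelta_mul_norm_le hn hrank hM h)
  refine ⟨w, hw1, ?_⟩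
  rintro _ ⟨M, hM, _, ⟨B, hB, rfl⟩, rfl⟩
  have h1 := hw _ (mem_image_of_mem T hM)
  have h2 : ‖T B‖ ≤ ‖h‖ := by
    have hB1 : ‖Matrix.toEuclideanCLM (n := Fin n) (𝕜 := ℝ) B‖ ≤ 1 := by
      rw [← Matrix.cstar_norm_def]; exact mem_closedBall_zero_iff.1 hB
    exact (ContinuousLinearMap.le_of_opNorm_le _ hB1 h).trans_eq (one_mul _)
  have h3 : -‖h‖ ≤ inner ℝ w (T B) := by
    have h4 := (abs_le.1 (abs_real_inner_le_norm w (T B))).1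
    have h5 : ‖w‖ * ‖T B‖ ≤ 1 * ‖h‖ := by gcongr
    linarith
  have h6 := mul_le_mul_of_nonneg_left h3 hδ
  change clarkeDelta f x₀ * ‖h‖ ≤ inner ℝ w (T (M + clarkeDelta f x₀ • B))
  rw [map_add, map_smul, inner_add_right, real_inner_smul_right]
  linarith

end MaximalRank

/-! ### The Lipschitz inverse -/

theorem mainTheorem1 (n : ℕ) (hn : 0 < n)
    (f : EuclideanSpace ℝ (Fin n) → EuclideanSpace ℝ (Fin n))
    (x₀ : EuclideanSpace ℝ (Fin n)) (K : ℝ≥0) (r δ : ℝ)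
    (hrank : OfMaximalRank (generalizedJacobian f x₀))
    (hδ : δ = clarkeDelta f x₀)
    (hr : 0 < r)
    (hLip : LipschitzOnWith K f (ball x₀ r))
    (hincl : ∀ x ∈ ball x₀ r, generalizedJacobian f x ⊆
      generalizedJacobian f x₀ + δ • closedBall (0 : Matrix (Fin n) (Fin n) ℝ) 1) :
    0 < δ ∧ 0 < K ∧
    ∃ (U V : Set (EuclideanSpace ℝ (Fin n)))
      (g : EuclideanSpace ℝ (Fin n) → EuclideanSpace ℝ (Fin n)),
      U = closedBall x₀ (r * δ / 2 * (1 / (K : ℝ))) ∧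
      V = closedBall (f x₀) (r * δ / 2) ∧
      U ∈ 𝓝 x₀ ∧ V ∈ 𝓝 (f x₀) ∧
      LipschitzOnWith (1 / δ).toNNReal g V ∧
      MapsTo f U V ∧
      (∀ u ∈ U, g (f u) = u) ∧
      (∀ v ∈ V, f (g v) = v) := by
  have hcpt := hLip.isCompact_generalizedJacobian hr
  have hne := hLip.generalizedJacobian_nonempty hr
  have hδ0 : 0 < δ := hδ ▸ clarkeDelta_pos hn hrank hcpt hne
  obtain ⟨F, hF, hFf⟩ := hLip.extend_finite_dimension
  have hw : ∀ h, ∃ w : EuclideanSpace ℝ (Fin n), ‖w‖ ≤ 1 ∧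
      ∀ x ∈ ball x₀ r, DifferentiableAt ℝ F x → δ * ‖h‖ ≤ inner ℝ w (fderiv ℝ F x h) := by
    intro h
    obtain ⟨w, hw1, hw⟩ := exists_forall_clarkeDelta_mul_norm_le_inner hn hrank hcpt hne h
    refine ⟨w, hw1, fun x hx hd => ?_⟩
    have heq : f =ᶠ[𝓝 x] F := hFf.eventuallyEq_of_mem (isOpen_ball.mem_nhds hx)
    rw [← heq.fderiv_eq, ← toEuclideanCLM_jacobianMatrix, hδ]
    exact hw _ (hδ ▸ hincl x hx
      (jacobianMatrix_mem_generalizedJacobian (hd.congr_of_eventuallyEq heq)))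
  have hlower : ∀ x ∈ ball x₀ r, ∀ y ∈ ball x₀ r, δ * ‖y - x‖ ≤ ‖f y - f x‖ := by
    intro x hx y hy
    rw [hFf hx, hFf hy]
    exact hF.mul_norm_sub_le_of_le_inner_fderiv hw hx hy
  have hx₀ : x₀ ∈ ball x₀ r := mem_ball_self hr
  have hhalf : closedBall x₀ (r / 2) ⊆ ball x₀ r := closedBall_subset_ball (half_lt_self hr)
  have hsurj : ∀ v ∈ closedBall (f x₀) (r * δ / 2), ∃ x ∈ closedBall x₀ (r / 2), f x = v := by
    intro v hv
    rw [hFf hx₀] at hv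
    obtain ⟨x, hx, hxv⟩ := hF.closedBall_subset_image_of_le_inner_fderiv hw hδ0 hr hv
    exact ⟨x, hx, (hFf (hhalf hx)).trans hxv⟩
  -- Comparing the two Lipschitz bounds at a point other than `x₀`, which exists since `0 < n`.
  have hδK : δ ≤ K := by
    have : Nonempty (Fin n) := ⟨⟨0, hn⟩⟩
    obtain ⟨z, hz⟩ := exists_norm_eq (EuclideanSpace ℝ (Fin n)) (half_pos hr).le
    have hmem : x₀ + z ∈ ball x₀ r := hhalf (by simp [hz])
    have h1 := hlower x₀ hx₀ _ hmem
    have h2 := hLip.norm_sub_le hmem hx₀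
    rw [add_sub_cancel_left, hz] at h1 h2
    exact le_of_mul_le_mul_right (h1.trans h2) (half_pos hr)
  have hK : (0 : ℝ) < K := hδ0.trans_le hδK
  have hU : closedBall x₀ (r * δ / 2 * (1 / (K : ℝ))) ⊆ closedBall x₀ (r / 2) := by
    refine closedBall_subset_closedBall ?_
    rw [mul_one_div, div_le_iff₀ hK]
    nlinarith
  have hmaps : MapsTo f (closedBall x₀ (r * δ / 2 * (1 / (K : ℝ))))
      (closedBall (f x₀) (r * δ / 2)) := by
    intro u hu
    rw [mem_closedBall_iff_norm]
    have h1 := hLip.norm_sub_le (hhalf (hU hu)) hx₀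
    rw [mem_closedBall_iff_norm, mul_one_div, le_div_iff₀' hK] at hu
    exact h1.trans hu
  choose! g hg hfg using hsurj
  refine ⟨hδ0, hK, _, _, g, rfl, rfl, closedBall_mem_nhds _ (by positivity),
    closedBall_mem_nhds _ (by positivity), ?_, hmaps, fun u hu => ?_, hfg⟩
  · refine LipschitzOnWith.of_dist_le_mul fun v hv v' hv' => ?_
    have h := hlower _ (hhalf (hg v' hv')) _ (hhalf (hg v hv))
    rw [hfg v hv, hfg v' hv'] at h
    rw [Real.coe_toNNReal _ (by positivity), dist_eq_norm, dist_eq_norm, one_div_mul_eq_div,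
      le_div_iff₀' hδ0]
    exact h
  · have hv := hmaps hu
    have h := hlower _ (hhalf (hU hu)) _ (hhalf (hg _ hv))
    rw [hfg _ hv, sub_self, norm_zero] at h
    exact sub_eq_zero.1 (norm_le_zero_iff.1 (nonpos_of_mul_nonpos_right h hδ0))
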